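/- Let $\mathbb{F}_q$ be the finite field with $q$ elements, listed as $\alpha_1=0<\alpha_2<\cdots<\alpha_q$ in an arbitrary order beginning with $0$, and order $\mathbb{F}_q^m$ lexicographically, so that $\mathbb{F}_q^m=\{P_1<P_2<\cdots<P_{q^m}\}$. For integers $m\ge 1$ and $r\ge 0$ let $$RM_q(r,m)=\{(f(P_1),\dots,f(P_{q^m})) : f\in\mathbb{F}_q[X_1,\dots,X_m],\ \deg f\le r\}\subseteq \mathbb{F}_q^{q^m}.$$ For $1\le b\le n$ and $\mathbf{x}\in\mathbb{F}_q^n$, the $b$-symbol weight $w_b(\mathbf{x})$ is the number of $i\in\{1,\dots,n\}$ such that $(x_i,x_{i+1},\dots,x_{i+b-1})\ne(0,\dots,0)$, where indices are read cyclically modulo $n$. The minimum $b$-symbol distance of a nonzero linear code $C\subseteq\mathbb{F}_q^n$ is $d_b(C)=\min_{\mathbf{c}\ne\mathbf{c}'\in C}w_b(\mathbf{c}-\mathbf{c}')$, and $C$, of dimension $k$, is called a $b$-symbol MDS code if $d_b(C)=\min\{n-k+b,\,n\}$. (For $b=1$ this is the usual notion of an MDS code for the Hamming distance.) Let $m\ge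 1$, $r\ge 0$, and write $r=t(q-1)+s$ with integers $t\ge 0$ and $0\le s<q-1$. Let $1\le b\le q^m$. Then $RM_q(r,m)$ is a $b$-symbol MDS code if and only if at least one of the following holds: (a) $b\ge q^m-(q-s)q^{m-t-1}+1$ (an inequality of rational numbers; the exponent $m-t-1$ may be negative); (b) $RM_q(r,m)$ is a $1$-symbol MDS code. -/

import Mathlib

namespace BSymbol

/-- The `b`-symbol support of `x = (x_0, …, x_{n-1})`: the positions `i` at which the window
`(x_i, x_{i+1}, …, x_{i+b-1})` of `b` consecutive entries, with indices read cyclically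
modulo `n`, is not the zero window. -/
def support {F : Type*} [Zero F] {n : ℕ} (b : ℕ) (x : Fin n → F) : Set (Fin n) :=
  {i | ∃ j < b, x ⟨((i : ℕ) + j) % n, Nat.mod_lt _ i.pos⟩ ≠ 0}

/-- The `b`-symbol weight: the size of the `b`-symbol support. -/
noncomputable def weight {F : Type*} [Zero F] {n : ℕ} (b : ℕ) (x : Fin n → F) : ℕ :=
  (support b x).ncard

/-- The `b`-symbol distance. -/
noncomputable def dist {F : Type*} [AddGroup F] {n : ℕ} (b : ℕ) (x y : Fin n → F) : ℕ :=
  weight b (x - y)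

/-- The minimum `b`-symbol distance of a linear code `C` of length `n`. It is a genuine minimum
as soon as `C` is nonzero (the infimum of the empty set of naturals is `0`). -/
noncomputable def minDist {F : Type*} [Field F] {n : ℕ} (b : ℕ)
    (C : Submodule F (Fin n → F)) : ℕ :=
  sInf {d | ∃ c ∈ C, ∃ c' ∈ C, c ≠ c' ∧ dist b c c' = d}

/-- `C`, a linear code of length `n` and dimension `k`, is a `b`-symbol MDS code when its minimum
`b`-symbol distance is `min (n - k + b) n`. (Here `k ≤ n`, so the subtraction is exact.) -/
def IsMDS {F : Type*} [Field F] {n : ℕ} (b : ℕ) (C : Submodule F (Fin n → F)) : Prop :=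
  minDist b C = min (n - Module.finrank F C + b) n

/-- The points `P_0 < P_1 < ⋯ < P_{q^m-1}` of `F ^ m`, listed increasingly for the lexicographic
order induced by the given linear order on `F`, where `q = |F|`. -/
noncomputable def point (F : Type*) [Fintype F] [LinearOrder F] (m : ℕ) :
    Fin (Fintype.card F ^ m) ≃o Lex (Fin m → F) :=
  monoEquivOfFin (Lex (Fin m → F)) (by simp [Fintype.card_lex])

/-- Evaluation of a polynomial in `m` variables at all the points of `F ^ m`, in order. -/
noncomputable def evalPoints (F : Type*) [Field F] [Fintype F] [LinearOrder F] (m : ℕ) :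
    MvPolynomial (Fin m) F →ₗ[F] (Fin (Fintype.card F ^ m) → F) :=
  LinearMap.pi fun i => (MvPolynomial.aeval (ofLex (point F m i))).toLinearMap

/-- The Reed-Muller code `RM_q(r, m)` over `F`, `q = |F|`: all the words
`(f(P_0), f(P_1), …, f(P_{q^m-1}))` with `f` a polynomial in `m` variables over `F`
of total degree at most `r`. -/
noncomputable def reedMuller (F : Type*) [Field F] [Fintype F] [LinearOrder F] (r m : ℕ) :
    Submodule F (Fin (Fintype.card F ^ m) → F) :=
  (MvPolynomial.restrictTotalDegree (Fin m) F r).map (evalPoints F m)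

theorem mem_reedMuller {F : Type*} [Field F] [Fintype F] [LinearOrder F] {r m : ℕ}
    {c : Fin (Fintype.card F ^ m) → F} :
    c ∈ reedMuller F r m ↔ ∃ f : MvPolynomial (Fin m) F, f.totalDegree ≤ r ∧
      ∀ i, MvPolynomial.eval (ofLex (point F m i)) f = c i := by
  simp only [reedMuller, Submodule.mem_map, MvPolynomial.mem_restrictTotalDegree, funext_iff]
  rfl

end BSymbol

/-! Put n = q^m, k the dimension, and d = (q-s)q^(m-t-1), to be replaced by 1 when t ≥ m.
Lengthening the window by one enlarges the support of a nonzero word unless it is already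
everything, so d_b ≥ min(d_1+b-1, n). With the Singleton bound d_b ≤ min(n-k+b, n), this shows that
1-symbol MDS implies b-symbol MDS, and that d_1+b-1 ≥ n also suffices. For the converse with t < m,
two facts are needed: d ≤ d_1 (`rmDist_le_card_filter`), and some nonzero codeword is supported on
the last d positions (`exists_mem_reedMuller_last`). That word has b-symbol weight at most d+b-1. If
this is below n, b-symbol MDS forces n-k+b ≤ d+b-1, so d_1 ≥ n-k+1. If t ≥ m the code is the whole
space and is always MDS. -/

namespace BSymbol

/-! ### Growth of the weight with the window length -/

section Weight

variable {F : Type*} [Zero F] {n : ℕ}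

theorem support_mono {b b' : ℕ} (h : b ≤ b') (x : Fin n → F) : support b x ⊆ support b' x :=
  fun _ ⟨j, hj, hx⟩ => ⟨j, hj.trans_le h, hx⟩

theorem mem_support_of_ne_zero {b : ℕ} (hb : 1 ≤ b) {x : Fin n → F} {i : Fin n} (hi : x i ≠ 0) :
    i ∈ support b x := by
  refine ⟨0, hb, ?_⟩
  have : (⟨((i : ℕ) + 0) % n, Nat.mod_lt _ i.pos⟩ : Fin n) = i :=
    Fin.ext (by simp [Nat.mod_eq_of_lt i.isLt])
  rwa [this]

theorem support_one (x : Fin n → F) : support 1 x = {i | x i ≠ 0} := by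
  ext i
  refine ⟨fun ⟨j, hj, hx⟩ => ?_, mem_support_of_ne_zero le_rfl⟩
  obtain rfl : j = 0 := by omega
  have : (⟨((i : ℕ) + 0) % n, Nat.mod_lt _ i.pos⟩ : Fin n) = i :=
    Fin.ext (by simp [Nat.mod_eq_of_lt i.isLt])
  rwa [this] at hx

theorem mem_support_succ {b : ℕ} {x : Fin n → F} {i : Fin n}
    (h : (⟨((i : ℕ) + 1) % n, Nat.mod_lt _ i.pos⟩ : Fin n) ∈ support b x) :
    i ∈ support (b + 1) x := by
  obtain ⟨j, hj, hx⟩ := h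
  refine ⟨j + 1, by omega, ?_⟩
  have : (⟨((i : ℕ) + (j + 1)) % n, Nat.mod_lt _ i.pos⟩ : Fin n)
      = ⟨(((i : ℕ) + 1) % n + j) % n, Nat.mod_lt _ i.pos⟩ :=
    Fin.ext (by simp [Nat.mod_add_mod, add_assoc, add_comm 1 j])
  rwa [this]

/-- A nonempty set of residues closed under predecessor is everything. -/
theorem eq_univ_of_closed_pred {S : Set (Fin n)} (hS : S.Nonempty)
    (h : ∀ i : Fin n, (⟨((i : ℕ) + 1) % n, Nat.mod_lt _ i.pos⟩ : Fin n) ∈ S → i ∈ S) :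
    S = Set.univ := by
  obtain ⟨i₀, hi₀⟩ := hS
  have key : ∀ (j : ℕ) (i : Fin n),
      (⟨((i : ℕ) + j) % n, Nat.mod_lt _ i.pos⟩ : Fin n) ∈ S → i ∈ S := by
    intro j
    induction j with
    | zero =>
      intro i hi
      have : (⟨((i : ℕ) + 0) % n, Nat.mod_lt _ i.pos⟩ : Fin n) = i :=
        Fin.ext (by simp [Nat.mod_eq_of_lt i.isLt])
      rwa [this] at hi
    | succ j ih =>
      intro i hi
      refine h i (ih _ ?_)
      have : (⟨((i : ℕ) + (j + 1)) % n, Nat.mod_lt _ i.pos⟩ : Fin n)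
          = ⟨(((i : ℕ) + 1) % n + j) % n, Nat.mod_lt _ i.pos⟩ :=
        Fin.ext (by simp [Nat.mod_add_mod, add_assoc, add_comm 1 j])
      rwa [this] at hi
  -- The number of cyclic steps from `k` forward to `i₀`; the extra `n` prevents truncation.
  refine Set.eq_univ_of_forall fun k => key ((i₀ : ℕ) + n - k) k ?_
  have : (⟨((k : ℕ) + ((i₀ : ℕ) + n - k)) % n, Nat.mod_lt _ k.pos⟩ : Fin n) = i₀ := by
    refine Fin.ext ?_
    have hk := k.isLt
    have : (k : ℕ) + ((i₀ : ℕ) + n - k) = i₀ + n := by omega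
    simp [this, Nat.mod_eq_of_lt i₀.isLt]
  rwa [this]

theorem weight_le_length (b : ℕ) (x : Fin n → F) : weight b x ≤ n := by
  simpa [weight] using Set.ncard_le_card (support b x)

/-- A proper nonempty support has a member whose cyclic predecessor lies outside it; the longer
window catches that predecessor. -/
theorem min_weight_add_one_le {b : ℕ} (hb : 1 ≤ b) {x : Fin n → F} (hx : x ≠ 0) :
    min (weight b x + 1) n ≤ weight (b + 1) x := by
  obtain ⟨i₀, hi₀⟩ := Function.ne_iff.mp hx
  by_cases hu : support b x = Set.univ
  · have : support (b + 1) x = Set.univ :=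
      Set.eq_univ_of_univ_subset (hu ▸ support_mono (Nat.le_succ b) x)
    simp [weight, this, Set.ncard_univ]
  · obtain ⟨i, hi, hi'⟩ : ∃ i : Fin n,
        (⟨((i : ℕ) + 1) % n, Nat.mod_lt _ i.pos⟩ : Fin n) ∈ support b x ∧ i ∉ support b x := by
      by_contra! h
      exact hu (eq_univ_of_closed_pred ⟨i₀, mem_support_of_ne_zero hb hi₀⟩ h)
    refine (min_le_left _ _).trans ?_
    rw [weight, ← Set.ncard_insert_of_notMem hi' (Set.toFinite _)]
    exact Set.ncard_le_ncard (Set.insert_subset (mem_support_succ hi)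
      (support_mono (Nat.le_succ b) x)) (Set.toFinite _)

theorem min_weight_one_add_le {b : ℕ} {x : Fin n → F} (hx : x ≠ 0) :
    min (weight 1 x + b) n ≤ weight (b + 1) x := by
  induction b with
  | zero => simp
  | succ b ih =>
    have := min_weight_add_one_le (Nat.le_add_left 1 b) hx
    omega

/-- A word supported on the last `e` positions has `b`-symbol weight at most `e + b - 1`. -/
theorem weight_le_of_forall_lt {b e : ℕ} (he : 1 ≤ e) {x : Fin n → F}
    (hx : ∀ i : Fin n, (i : ℕ) + e < n → x i = 0) : weight (b + 1) x ≤ e + b := by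
  have hsub : support (b + 1) x ⊆ {i : Fin n | n ≤ (i : ℕ) + (e + b)} := by
    rintro i ⟨j, hj, hij⟩
    have h : n ≤ ((i : ℕ) + j) % n + e := by
      by_contra! h
      exact hij (hx _ h)
    rcases lt_or_ge ((i : ℕ) + j) n with h' | h'
    · rw [Nat.mod_eq_of_lt h'] at h
      change n ≤ (i : ℕ) + (e + b)
      omega
    · change n ≤ (i : ℕ) + (e + b)
      omega
  refine (Set.ncard_le_ncard hsub (Set.toFinite _)).trans ?_
  have hinj : ((fun i : Fin n => (i : ℕ)) '' {i : Fin n | n ≤ (i : ℕ) + (e + b)})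
      ⊆ (Finset.Ico (n - (e + b)) n : Finset ℕ) := by
    rintro _ ⟨i, hi, rfl⟩
    have hi' : n ≤ (i : ℕ) + (e + b) := hi
    simp only [Finset.coe_Ico, Set.mem_Ico]
    omega
  rw [← Set.ncard_image_of_injective _ Fin.val_injective]
  refine (Set.ncard_le_ncard hinj (Finset.finite_toSet _)).trans ?_
  rw [Set.ncard_coe_finset, Nat.card_Ico]
  omega

end Weight

/-! ### Singleton bound and MDS criteria for linear codes -/

section Code

variable {F : Type*} [Field F] {n : ℕ} {C : Submodule F (Fin n → F)}

theorem minDist_le {b : ℕ} {c : Fin n → F} (hc : c ∈ C) (h0 : c ≠ 0) :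
    minDist b C ≤ weight b c :=
  Nat.sInf_le ⟨c, hc, 0, C.zero_mem, h0, by simp [dist]⟩

theorem exists_weight_eq_minDist (b : ℕ) (hC : C ≠ ⊥) :
    ∃ c ∈ C, c ≠ 0 ∧ weight b c = minDist b C := by
  obtain ⟨c, hc, h0⟩ := C.ne_bot_iff.mp hC
  obtain ⟨x, hx, y, hy, hne, h⟩ := Nat.sInf_mem
    (s := {d | ∃ c ∈ C, ∃ c' ∈ C, c ≠ c' ∧ dist b c c' = d}) ⟨_, c, hc, 0, C.zero_mem, h0, rfl⟩
  exact ⟨x - y, C.sub_mem hx hy, sub_ne_zero.mpr hne, h⟩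

theorem finrank_pos (hC : C ≠ ⊥) : 1 ≤ Module.finrank F C :=
  Submodule.one_le_finrank_iff.mpr hC

theorem finrank_le_length : Module.finrank F C ≤ n := by
  simpa using C.finrank_le

/-- A code of dimension `k` has a nonzero codeword that vanishes on the first `k - 1` positions. -/
theorem exists_mem_forall_lt_eq_zero (hC : C ≠ ⊥) :
    ∃ c ∈ C, c ≠ 0 ∧ ∀ i : Fin n, (i : ℕ) < Module.finrank F C - 1 → c i = 0 := by
  have hk := finrank_pos hC
  have hkn : Module.finrank F C ≤ n := finrank_le_length
  let T : C →ₗ[F] (Fin (Module.finrank F C - 1) → F) :=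
    (LinearMap.funLeft F F (Fin.castLE (by omega : Module.finrank F C - 1 ≤ n))).comp C.subtype
  have hT : LinearMap.ker T ≠ ⊥ := LinearMap.ker_ne_bot_of_finrank_lt (by simp; omega)
  obtain ⟨c, hc, h0⟩ := (Submodule.ne_bot_iff _).mp hT
  refine ⟨c, c.2, by simpa using h0, fun i hi => ?_⟩
  exact congrFun (LinearMap.mem_ker.mp hc) ⟨i, hi⟩

/-- The Singleton bound for the `b`-symbol distance. -/
theorem minDist_le_min (b : ℕ) (hC : C ≠ ⊥) :
    minDist (b + 1) C ≤ min (n - Module.finrank F C + (b + 1)) n := by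
  obtain ⟨c, hc, h0, hz⟩ := exists_mem_forall_lt_eq_zero hC
  have hk := finrank_pos hC
  have hkn : Module.finrank F C ≤ n := finrank_le_length
  refine (minDist_le hc h0).trans (le_min ?_ (weight_le_length _ _))
  have := weight_le_of_forall_lt (b := b) (e := n - Module.finrank F C + 1) (by omega)
    (fun i hi => hz i (by omega))
  omega

theorem minDist_one_le (hC : C ≠ ⊥) : minDist 1 C ≤ n - Module.finrank F C + 1 :=
  (minDist_le_min 0 hC).trans (min_le_left _ _)

theorem min_minDist_one_add_le (b : ℕ) (hC : C ≠ ⊥) :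
    min (minDist 1 C + b) n ≤ minDist (b + 1) C := by
  obtain ⟨c, hc, h0, hw⟩ := exists_weight_eq_minDist (b + 1) hC
  have h1 := minDist_le (b := 1) hc h0
  have h2 := min_weight_one_add_le (b := b) h0
  omega

theorem IsMDS.of_one (b : ℕ) (hC : C ≠ ⊥) (h : IsMDS 1 C) : IsMDS (b + 1) C := by
  have h1 := minDist_le_min b hC
  have h2 := min_minDist_one_add_le b hC
  have hk := finrank_pos hC
  have hkn : Module.finrank F C ≤ n := finrank_le_length
  unfold IsMDS at *
  omega

theorem isMDS_of_length_le {b : ℕ} (hC : C ≠ ⊥) (h : n ≤ minDist 1 C + b) : IsMDS (b + 1) C := by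
  have h1 := minDist_le_min b hC
  have h2 := min_minDist_one_add_le b hC
  have h3 := minDist_one_le hC
  have hkn : Module.finrank F C ≤ n := finrank_le_length
  unfold IsMDS at *
  omega

/-- If a nonzero codeword is supported on the last `d` positions, where `d` is a lower bound for
the Hamming distance, then for small `b` the `b`-symbol MDS property implies the MDS property. -/
theorem IsMDS.one_of_lt {b d : ℕ} (hC : C ≠ ⊥) (hd : 1 ≤ d) (hmin : d ≤ minDist 1 C)
    {c : Fin n → F} (hc : c ∈ C) (h0 : c ≠ 0) (hlast : ∀ i : Fin n, (i : ℕ) + d < n → c i = 0)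
    (hlt : d + b < n) (h : IsMDS (b + 1) C) : IsMDS 1 C := by
  -- As `d + b < n`, the minimum defining MDS is not `n`, so it is the Singleton term.
  have h1 := (minDist_le (b := b + 1) hc h0).trans (weight_le_of_forall_lt hd hlast)
  have h2 := minDist_one_le hC
  have hk := finrank_pos hC
  have hkn : Module.finrank F C ≤ n := finrank_le_length
  unfold IsMDS at *
  omega

theorem minDist_top (hn : 1 ≤ n) : minDist 1 (⊤ : Submodule F (Fin n → F)) = 1 := by
  have hC : (⊤ : Submodule F (Fin n → F)) ≠ ⊥ := by
    have : Nonempty (Fin n) := ⟨⟨0, hn⟩⟩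
    exact top_ne_bot
  refine le_antisymm (by simpa using minDist_one_le hC) ?_
  obtain ⟨c, -, h0, hw⟩ := exists_weight_eq_minDist 1 hC
  rw [← hw, weight, support_one, Nat.one_le_iff_ne_zero]
  obtain ⟨i, hi⟩ := Function.ne_iff.mp h0
  exact (Set.ncard_pos (Set.toFinite _)).mpr ⟨i, hi⟩ |>.ne'

theorem isMDS_one_top (hn : 1 ≤ n) : IsMDS 1 (⊤ : Submodule F (Fin n → F)) := by
  simp only [IsMDS, minDist_top hn, finrank_top, Module.finrank_fin_fun]
  omega

end Code

/-! ### Lower bound on the number of nonzeros of a polynomial -/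

section Polynomial

open MvPolynomial

variable {F : Type*} [Field F] {M : ℕ}

theorem exists_eval_cons_monomial_eq (e : Fin (M + 1) →₀ ℕ) (c a : F) :
    ∃ g : MvPolynomial (Fin (M + 1)) F, g.totalDegree ≤ (e.sum fun _ k => k) - 1 ∧
      ∀ y x, eval (Fin.cons y x) (monomial e c) =
        eval (Fin.cons a x) (monomial e c) + (y - a) * eval (Fin.cons y x) g := by
  have hsum : (e.sum fun _ k => k) = e 0 + ∑ i : Fin M, e i.succ := by
    rw [Finsupp.sum_fintype _ _ (fun _ => rfl), Fin.sum_univ_succ]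
  -- The quotient of X_0^e - a^e by X_0 - a, as a geometric sum, times the rest of the monomial.
  refine ⟨C c * (∏ i : Fin M, X i.succ ^ e i.succ) *
    ∑ i ∈ Finset.range (e 0), X 0 ^ i * C a ^ (e 0 - 1 - i), ?_, fun y x => ?_⟩
  · rcases Nat.eq_zero_or_pos (e 0) with h | h
    · simp [h]
    have h1 : (C c * (∏ i : Fin M, X i.succ ^ e i.succ) :
        MvPolynomial (Fin (M + 1)) F).totalDegree ≤ ∑ i : Fin M, e i.succ := by
      refine (totalDegree_mul _ _).trans ?_
      rw [totalDegree_C, zero_add]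
      refine (totalDegree_finsetProd _ _).trans (Finset.sum_le_sum fun i _ => ?_)
      rw [totalDegree_X_pow]
    have h2 : (∑ i ∈ Finset.range (e 0), X 0 ^ i * C a ^ (e 0 - 1 - i) :
        MvPolynomial (Fin (M + 1)) F).totalDegree ≤ e 0 - 1 := by
      refine totalDegree_finsetSum_le fun i hi => (totalDegree_mul _ _).trans ?_
      rw [totalDegree_X_pow, ← C_pow, totalDegree_C]
      have := Finset.mem_range.mp hi
      omega
    refine (totalDegree_mul _ _).trans ?_
    omega
  · have hgeom := geom_sum₂_mul y a (e 0)
    simp only [eval_monomial, Finsupp.prod_fintype _ _ (fun _ => pow_zero _), Fin.prod_univ_succ,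
      Fin.cons_zero, Fin.cons_succ, map_mul, map_sum, map_prod, map_pow, eval_X, eval_C]
    linear_combination (-c * ∏ i : Fin M, x i ^ e i.succ) * hgeom

theorem exists_eval_cons_eq (f : MvPolynomial (Fin (M + 1)) F) (a : F) :
    ∃ g : MvPolynomial (Fin (M + 1)) F, g.totalDegree ≤ f.totalDegree - 1 ∧
      ∀ y x, eval (Fin.cons y x) f = eval (Fin.cons a x) f + (y - a) * eval (Fin.cons y x) g := by
  choose g hg hg' using fun e : Fin (M + 1) →₀ ℕ => exists_eval_cons_monomial_eq e (coeff e f) a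
  refine ⟨∑ e ∈ f.support, g e, totalDegree_finsetSum_le fun e he => (hg e).trans
    (Nat.sub_le_sub_right (le_totalDegree he) 1), fun y x => ?_⟩
  have h (z : Fin (M + 1) → F) : eval z f = ∑ e ∈ f.support, eval z (monomial e (coeff e f)) := by
    rw [← map_sum, support_sum_monomial_coeff]
  rw [h, h, map_sum, Finset.mul_sum, ← Finset.sum_add_distrib]
  exact Finset.sum_congr rfl fun e _ => hg' e y x

theorem exists_eval_eq_eval_cons (f : MvPolynomial (Fin (M + 1)) F) (a : F) :
    ∃ g : MvPolynomial (Fin M) F, g.totalDegree ≤ f.totalDegree ∧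
      ∀ x, eval x g = eval (Fin.cons a x) f := by
  refine ⟨(finSuccEquiv F M f).eval (C a), ?_, fun x => ?_⟩
  · rw [Polynomial.eval_eq_sum]
    refine totalDegree_finsetSum_le fun i hi => (totalDegree_mul _ _).trans ?_
    rw [← C_pow, totalDegree_C]
    have := totalDegree_coeff_finSuccEquiv_add_le f i (Polynomial.mem_support_iff.mp hi)
    omega
  · rw [eval_eq_eval_mv_eval', Polynomial.eval_map, Polynomial.eval₂_eq_sum,
      Polynomial.eval_eq_sum, Polynomial.sum, Polynomial.sum, map_sum]
    simp

/-- A polynomial function vanishing on the hyperplanes `X_0 = a`, `a ∈ Z`, is the product of the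
linear forms `X_0 - a` and of a polynomial function of accordingly lower degree. -/
theorem exists_eval_eq_prod_mul (f : MvPolynomial (Fin (M + 1)) F) (hf : ∃ x, eval x f ≠ 0)
    (Z : Finset F) (hZ : ∀ a ∈ Z, ∀ x, eval (Fin.cons a x) f = 0) :
    ∃ g : MvPolynomial (Fin (M + 1)) F, g.totalDegree + Z.card ≤ f.totalDegree ∧
      ∀ y x, eval (Fin.cons y x) f = (∏ a ∈ Z, (y - a)) * eval (Fin.cons y x) g := by
  classical
  induction Z using Finset.induction_on with
  | empty => exact ⟨f, by simp⟩
  | insert a Z ha ih =>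
    obtain ⟨g, hg, hfg⟩ := ih fun b hb => hZ b (Finset.mem_insert_of_mem hb)
    have hga (x : Fin M → F) : eval (Fin.cons a x) g = 0 := by
      have h := hZ a (Finset.mem_insert_self a Z) x
      rw [hfg] at h
      refine (mul_eq_zero.mp h).resolve_left (Finset.prod_ne_zero_iff.mpr fun b hb => ?_)
      exact sub_ne_zero.mpr fun h => ha (h ▸ hb)
    -- A constant `g` vanishing on a slice would be zero, and then so would `f`; hence the truncated
    -- `- 1` is a true drop in degree.
    have hdeg : 1 ≤ g.totalDegree := by
      by_contra! h
      have hC := totalDegree_eq_zero_iff_eq_C.mp (Nat.lt_one_iff.mp h)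
      have h0 := hga 0
      rw [hC, eval_C] at h0
      obtain ⟨x, hx⟩ := hf
      refine hx ?_
      rw [← Fin.cons_self_tail x, hfg, hC, h0]
      simp
    obtain ⟨g', hg', hgg'⟩ := exists_eval_cons_eq g a
    refine ⟨g', ?_, fun y x => ?_⟩
    · rw [Finset.card_insert_of_notMem ha]
      omega
    · rw [hfg, hgg', hga, Finset.prod_insert ha]
      ring

/-- The minimum Hamming distance of the Reed-Muller code of order `t * (q - 1) + s` in `m`
variables. -/
def rmDist (q m t s : ℕ) : ℕ := if t < m then (q - s) * q ^ (m - t - 1) else 1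

theorem rmDist_of_lt {q m t s : ℕ} (h : t < m) : rmDist q m t s = (q - s) * q ^ (m - t - 1) :=
  if_pos h

/-- For t < m, (q-z)(q-s+z) - (q-s)q = z(s-z) ≥ 0. -/
theorem rmDist_succ_le_of_le {q m t s z : ℕ} (hs : s < q) (hz : z ≤ s) :
    rmDist q (m + 1) t s ≤ (q - z) * rmDist q m t (s - z) := by
  rcases lt_trichotomy t m with h | rfl | h
  · rw [rmDist_of_lt h, rmDist_of_lt (by omega), ← mul_assoc,
      show m + 1 - t - 1 = (m - t - 1) + 1 by omega, pow_succ', ← mul_assoc]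
    refine Nat.mul_le_mul_right _ ?_
    obtain ⟨u, rfl⟩ := Nat.exists_eq_add_of_le hz
    obtain ⟨v, rfl⟩ := Nat.exists_eq_add_of_lt hs
    rw [show z + u + v + 1 - (z + u) = v + 1 by omega, show z + u + v + 1 - z = u + v + 1 by omega,
      show z + u - z = u by omega, show z + u + v + 1 - u = z + v + 1 by omega]
    nlinarith [Nat.zero_le (u * z)]
  · simp [rmDist]
    omega
  · simp [rmDist, show ¬ t < m + 1 by omega, show ¬ t < m by omega]
    omega

/-- The case where subtracting z borrows q-1 from the leading digit. For t < m, (q-z)(z-s+1) - (q-s)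
= (q-z-1)(z-s) ≥ 0. -/
theorem rmDist_succ_le_of_lt {q m t s z : ℕ} (hz : s < z) (hzq : z < q) :
    rmDist q (m + 1) (t + 1) s ≤ (q - z) * rmDist q m t (q - 1 + s - z) := by
  by_cases h : t < m
  · rw [rmDist_of_lt h, rmDist_of_lt (by omega), ← mul_assoc,
      show m + 1 - (t + 1) - 1 = m - t - 1 by omega]
    refine Nat.mul_le_mul_right _ ?_
    obtain ⟨u, rfl⟩ := Nat.exists_eq_add_of_lt hz
    obtain ⟨v, rfl⟩ := Nat.exists_eq_add_of_lt hzq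
    rw [show s + u + 1 + v + 1 - (s + u + 1) = v + 1 by omega,
      show s + u + 1 + v + 1 - s = u + v + 2 by omega,
      show s + u + 1 + v + 1 - (s + u + 1 + v + 1 - 1 + s - (s + u + 1)) = u + 2 by omega]
    nlinarith [Nat.zero_le (u * v)]
  · simp [rmDist, h]
    omega

theorem card_filter_cons {α : Type*} [Fintype α] {P : (Fin (M + 1) → α) → Prop}
    [DecidablePred P] : (Finset.univ.filter P).card =
      ∑ a : α, (Finset.univ.filter fun x : Fin M → α => P (Fin.cons a x)).card := by
  simp only [Finset.card_filter]
  rw [← (Fin.consEquiv fun _ : Fin (M + 1) => α).sum_comp, Fintype.sum_prod_type]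
  rfl

variable [Fintype F] [DecidableEq F]

/-- Induction on the number of variables, slicing by the value of X_0. If f vanishes on exactly z
slices, dividing out those linear forms leaves degree at most deg f - z, and each of the other q-z
slices is nonzero. -/
theorem rmDist_le_card_filter {t s : ℕ} (hs : s < Fintype.card F - 1) (f : MvPolynomial (Fin M) F)
    (hdeg : f.totalDegree ≤ t * (Fintype.card F - 1) + s) (hf : ∃ x, eval x f ≠ 0) :
    rmDist (Fintype.card F) M t s ≤ (Finset.univ.filter fun x => eval x f ≠ 0).card := by
  induction M generalizing t s with
  | zero =>
    obtain ⟨x, hx⟩ := hf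
    rw [rmDist, if_neg (Nat.not_lt_zero t)]
    exact Finset.card_pos.mpr ⟨x, Finset.mem_filter.mpr ⟨Finset.mem_univ x, hx⟩⟩
  | succ M ih =>
    set q := Fintype.card F
    let Z : Finset F := Finset.univ.filter fun a => ∀ x, eval (Fin.cons a x) f = 0
    obtain ⟨g, hg, hfg⟩ := exists_eval_eq_prod_mul f hf Z (fun a ha => (Finset.mem_filter.mp ha).2)
    have hZ : Z.card < q := by
      refine Finset.card_lt_univ_of_notMem (x := hf.choose 0) fun h => hf.choose_spec ?_
      have := (Finset.mem_filter.mp h).2 (Fin.tail hf.choose)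
      rwa [Fin.cons_self_tail] at this
    -- Here `t' * (q - 1) + s'` bounds the degree left after division.
    have key {t' s' : ℕ} (hs' : s' < q - 1)
        (hle : t * (q - 1) + s ≤ t' * (q - 1) + s' + Z.card) :
        (q - Z.card) * rmDist q M t' s' ≤ (Finset.univ.filter fun x => eval x f ≠ 0).card := by
      rw [card_filter_cons, ← Finset.card_compl, ← smul_eq_mul]
      refine (Finset.card_nsmul_le_sum Zᶜ _ _ fun a ha => ?_).trans
        (Finset.sum_le_sum_of_subset (Finset.subset_univ _))
      obtain ⟨g', hg', hgg'⟩ := exists_eval_eq_eval_cons g a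
      obtain ⟨x, hx⟩ : ∃ x, eval (Fin.cons a x) f ≠ 0 := by
        simpa [Z] using ha
      refine (ih hs' g' (by omega) ⟨x, fun h => hx ?_⟩).trans
        (Finset.card_le_card fun x hx => ?_)
      · rw [hfg, ← hgg', h, mul_zero]
      · simp only [Finset.mem_filter, Finset.mem_univ, true_and] at hx ⊢
        rw [hfg, ← hgg']
        refine mul_ne_zero (Finset.prod_ne_zero_iff.mpr fun b hb => sub_ne_zero.mpr ?_) hx
        rintro rfl
        exact Finset.mem_compl.mp ha hb
    rcases le_or_gt Z.card s with h | h
    · exact (rmDist_succ_le_of_le (by omega) h).trans (key (by omega) (by omega))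
    · cases t with
      | zero => omega
      | succ t =>
        refine (rmDist_succ_le_of_lt h hZ).trans (key (by omega) ?_)
        rw [Nat.succ_mul]
        omega

end Polynomial

/-! ### Upper sets in the lexicographic order -/

theorem length_le_of_mem_upperSet {n : ℕ} {U : Finset (Fin n)} (hU : IsUpperSet (U : Set (Fin n)))
    {i : Fin n} (hi : i ∈ U) : n ≤ (i : ℕ) + U.card := by
  have h : Finset.Ici i ⊆ U := fun j hj => hU (Finset.mem_Ici.mp hj) hi
  have := Finset.card_le_card h
  rw [Fin.card_Ici] at this
  omega

theorem exists_finset_isLowerSet_card_eq {F : Type*} [Fintype F] [LinearOrder F] {s : ℕ} (hs : s ≤ Fintype.card F) :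
    ∃ A : Finset F, A.card = s ∧ IsLowerSet (A : Set F) := by
  let e : Fin (Fintype.card F) ≃o F := monoEquivOfFin F rfl
  refine ⟨Finset.univ.map ((Fin.castLEEmb hs).trans e.toEquiv.toEmbedding), by simp, ?_⟩
  intro a b hba ha
  simp only [Finset.coe_map, Finset.coe_univ, Set.image_univ, Set.mem_range] at ha ⊢
  obtain ⟨i, rfl⟩ := ha
  have hlt : (e.symm b : ℕ) < s := by
    have : e.symm b ≤ Fin.castLE hs i := e.symm_apply_le.mpr hba
    exact (Fin.le_def.mp this).trans_lt i.isLt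
  exact ⟨⟨e.symm b, hlt⟩, e.apply_symm_apply b⟩

theorem card_filter_point {F : Type*} [Fintype F] [LinearOrder F] {m : ℕ} (P : (Fin m → F) → Prop) [DecidablePred P] :
    (Finset.univ.filter fun i => P (ofLex (point F m i))).card =
      (Finset.univ.filter P).card := by
  simp only [Finset.card_filter]
  exact ((point F m).toEquiv.trans ofLex).sum_comp fun x => if P x then 1 else 0

/-- A lexicographic increase cannot first occur at a coordinate before `t`, already maximal; at `t`
it cannot enter the lower set `A`. -/
theorem isUpperSet_lex_of_max {F : Type*} [LinearOrder F] {m : ℕ} {t : Fin m} {M : F} (hM : ∀ x, x ≤ M) {A : Set F}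
    (hA : IsLowerSet A) :
    IsUpperSet {x : Lex (Fin m → F) | (∀ i < t, ofLex x i = M) ∧ ofLex x t ∉ A} := by
  rintro x y hxy ⟨hx, hxt⟩
  rcases hxy.eq_or_lt with rfl | ⟨k, hk, hkl⟩
  · exact ⟨hx, hxt⟩
  rcases lt_trichotomy k t with h | rfl | h
  · exact absurd (hM (ofLex y k)) (not_le.mpr ((hx k h) ▸ hkl))
  · exact ⟨fun i hi => (hk i hi).symm.trans (hx i hi), fun hy => hxt (hA hkl.le hy)⟩
  · exact ⟨fun i hi => (hk i (hi.trans h)).symm.trans (hx i hi), fun hy => 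
      hxt (by rw [show ofLex x t = ofLex y t from hk t h]; exact hy)⟩

theorem card_filter_eq_max {F : Type*} [Fintype F] [LinearOrder F] {m : ℕ} (t : Fin m) (M : F)
    (A : Finset F) :
    (Finset.univ.filter fun x : Fin m → F => (∀ i < t, x i = M) ∧ x t ∉ A).card =
      rmDist (Fintype.card F) m t A.card := by
  have h : (Finset.univ.filter fun x : Fin m → F => (∀ i < t, x i = M) ∧ x t ∉ A) =
      Fintype.piFinset fun i => if i < t then {M} else if i = t then Aᶜ else Finset.univ := by
    ext x
    simp only [Finset.mem_filter, Finset.mem_univ, true_and, Fintype.mem_piFinset]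
    refine ⟨fun ⟨h1, h2⟩ i => ?_, fun h => ⟨fun i hi => by simpa [hi] using h i,
      by simpa using h t⟩⟩
    split_ifs with h h'
    · simpa using h1 i h
    · simpa [h'] using h2
    · simp
  have hcard (i : Fin m) :
      (if i < t then {M} else if i = t then Aᶜ else Finset.univ : Finset F).card =
        (fun j : ℕ => if j < t then 1 else if j = t then Fintype.card F - A.card
          else Fintype.card F) i := by
    simp only [Fin.lt_def, Fin.ext_iff]
    split_ifs
    · simp
    · exact Finset.card_compl A
    · rfl
  rw [h, Fintype.card_piFinset, Finset.prod_congr rfl fun i _ => hcard i,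
    Fin.prod_univ_eq_prod_range (fun j : ℕ => if j < t then 1 else if j = t then
      Fintype.card F - A.card else Fintype.card F), rmDist_of_lt t.isLt]
  obtain ⟨u, hu⟩ := Nat.exists_eq_add_of_lt t.isLt
  rw [show m - t - 1 = u by omega]
  have hrange : Finset.range m = Finset.range ((t + 1) + u) := congrArg _ (by omega)
  rw [hrange, Finset.prod_range_add, Finset.prod_range_succ, Finset.prod_eq_one fun j hj =>
    if_pos (Finset.mem_range.mp hj), Finset.prod_congr rfl (g := fun _ => Fintype.card F)
    fun j _ => by rw [if_neg (by omega), if_neg (by omega)]]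
  simp

/-! ### Reed-Muller codes: distance bound and extremal codeword -/

section ReedMuller

open MvPolynomial

variable {F : Type*} [Field F] [Fintype F] [LinearOrder F] {r m : ℕ}

theorem exists_totalDegree_le_eval_ne_zero_iff (t : Fin m) (M : F) (A : Finset F) :
    ∃ f : MvPolynomial (Fin m) F, f.totalDegree ≤ t * (Fintype.card F - 1) + A.card ∧
      ∀ x, eval x f ≠ 0 ↔ (∀ i < t, x i = M) ∧ x t ∉ A := by
  -- By Fermat, each factor of the first product is the indicator of x_i = M.
  refine ⟨(∏ i ∈ Finset.Iio t, (1 - (X i - C M) ^ (Fintype.card F - 1))) *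
    ∏ a ∈ A, (X t - C a), ?_, fun x => ?_⟩
  · have hX (i : Fin m) (a : F) : (X i - C a : MvPolynomial (Fin m) F).totalDegree ≤ 1 :=
      (totalDegree_sub_C_le _ _).trans (totalDegree_X i).le
    refine (totalDegree_mul _ _).trans (add_le_add ?_ ?_)
    · refine (totalDegree_finsetProd _ _).trans
        ((Finset.sum_le_card_nsmul _ _ (Fintype.card F - 1) fun i _ => ?_).trans (by simp))
      refine (totalDegree_sub _ _).trans (max_le (by simp) ((totalDegree_pow _ _).trans ?_))
      simpa using Nat.mul_le_mul_left _ (hX i M)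
    · refine (totalDegree_finsetProd _ _).trans
        ((Finset.sum_le_card_nsmul _ _ 1 fun a _ => hX t a).trans (by simp))
  · have hq : Fintype.card F - 1 ≠ 0 := (tsub_pos_of_lt Fintype.one_lt_card).ne'
    simp only [map_mul, map_prod, map_sub, map_one, map_pow, eval_X, eval_C, mul_ne_zero_iff,
      Finset.prod_ne_zero_iff, Finset.mem_Iio]
    refine and_congr (forall₂_congr fun i _ => ?_) ?_
    · by_cases h : x i = M
      · simp [h, hq]
      · simp [h, FiniteField.pow_card_sub_one_eq_one _ (sub_ne_zero.mpr h)]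
    · exact ⟨fun h hx => h _ hx (sub_self _), fun h a ha => sub_ne_zero.mpr fun e => h (e ▸ ha)⟩

theorem reedMuller_ne_bot : reedMuller F r m ≠ ⊥ := by
  refine (Submodule.ne_bot_iff _).mpr ⟨fun _ => 1, mem_reedMuller.mpr ⟨1, by simp, by simp⟩, ?_⟩
  have hn : 0 < Fintype.card F ^ m := pow_pos Fintype.card_pos m
  exact fun h => one_ne_zero (congrFun h ⟨0, hn⟩)

theorem rmDist_le_minDist_reedMuller {t s : ℕ} (hs : s < Fintype.card F - 1) :
    rmDist (Fintype.card F) m t s ≤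
      minDist 1 (reedMuller F (t * (Fintype.card F - 1) + s) m) := by
  obtain ⟨c, hc, h0, hw⟩ := exists_weight_eq_minDist 1
    (reedMuller_ne_bot (F := F) (r := t * (Fintype.card F - 1) + s) (m := m))
  obtain ⟨f, hf, hfc⟩ := mem_reedMuller.mp hc
  obtain ⟨i, hi⟩ := Function.ne_iff.mp h0
  refine (rmDist_le_card_filter hs f hf ⟨_, (hfc i).trans_ne hi⟩).trans_eq ?_
  rw [← hw, weight, support_one, ← card_filter_point, ← Set.ncard_coe_finset]
  simp [hfc]

/-- With `M` the largest element of `F` and `A` the `s` smallest, the support is an upper set, hence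
a final segment. -/
theorem exists_mem_reedMuller_last {t : Fin m} {s : ℕ} (hs : s < Fintype.card F - 1) :
    ∃ c ∈ reedMuller F (t * (Fintype.card F - 1) + s) m, c ≠ 0 ∧
      ∀ i : Fin (Fintype.card F ^ m), (i : ℕ) + rmDist (Fintype.card F) m t s < Fintype.card F ^ m → c i = 0 := by
  obtain ⟨M, hM⟩ := Finite.exists_max (id : F → F)
  obtain ⟨A, rfl, hA⟩ := exists_finset_isLowerSet_card_eq (F := F) (s := s) (by omega)
  obtain ⟨f, hf, hfx⟩ := exists_totalDegree_le_eval_ne_zero_iff t M A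
  let c : Fin (Fintype.card F ^ m) → F := fun i => eval (ofLex (point F m i)) f
  let U : Finset (Fin (Fintype.card F ^ m)) := Finset.univ.filter fun i => c i ≠ 0
  have hcard : U.card = rmDist (Fintype.card F) m t A.card := by
    rw [← card_filter_eq_max t M A, ← card_filter_point]
    exact congrArg Finset.card (Finset.filter_congr fun i _ => hfx _)
  have hU : IsUpperSet (U : Set (Fin (Fintype.card F ^ m))) := by
    intro i j hij hi
    have hi' := (hfx _).mp (Finset.mem_filter.mp (Finset.mem_coe.mp hi)).2
    exact Finset.mem_coe.mpr (Finset.mem_filter.mpr ⟨Finset.mem_univ j, (hfx _).mpr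
      (isUpperSet_lex_of_max hM hA ((point F m).monotone hij) hi')⟩)
  refine ⟨c, mem_reedMuller.mpr ⟨f, hf, fun _ => rfl⟩, fun h0 => ?_, fun i hi => ?_⟩
  · have hU0 : U.card = 0 := by simp [U, h0]
    rw [hcard, rmDist_of_lt t.isLt] at hU0
    exact (Nat.mul_pos (by omega) (pow_pos Fintype.card_pos _)).ne' hU0
  · by_contra h
    have := length_le_of_mem_upperSet hU (Finset.mem_filter.mpr ⟨Finset.mem_univ i, h⟩)
    omega

theorem reedMuller_eq_top (h : m * (Fintype.card F - 1) ≤ r) : reedMuller F r m = ⊤ := by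
  refine Submodule.eq_top_iff'.mpr fun c => mem_reedMuller.mpr
    -- Interpolation by point indicators, each of degree at most m(q-1).
    ⟨∑ j, C (c j) * indicator (ofLex (point F m j)), ?_, fun i => ?_⟩
  · refine totalDegree_finsetSum_le fun j _ => (totalDegree_mul _ _).trans ?_
    rw [totalDegree_C, zero_add]
    refine (totalDegree_le_degrees_card _).trans
      ((Multiset.card_le_card (degrees_indicator _)).trans (le_trans ?_ h))
    simp
  · rw [map_sum, Finset.sum_eq_single i]
    · simp [eval_indicator_apply_eq_one]
    · intro j _ hj
      rw [map_mul, eval_indicator_apply_eq_zero, mul_zero]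
      exact fun he => hj ((point F m).injective (ofLex.injective he)).symm
    · simp

end ReedMuller

end BSymbol

/-! ### The equivalence -/

theorem corollary4p7 {F : Type*} [Field F] [Fintype F] [LinearOrder F]
    (h0 : ∀ x : F, 0 ≤ x) (q : ℕ) (hq : Fintype.card F = q)
    (m r t s : ℕ) (hm : 1 ≤ m) (hr : r = t * (q - 1) + s) (hs : s < q - 1)
    (b : ℕ) (hb1 : 1 ≤ b) (hbn : b ≤ q ^ m) :
    BSymbol.IsMDS b (BSymbol.reedMuller F r m) ↔
      ((b : ℚ) ≥ (q : ℚ) ^ m - ((q : ℚ) - (s : ℚ)) * (q : ℚ) ^ ((m : ℤ) - (t : ℤ) - 1) + 1 ∨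
        BSymbol.IsMDS 1 (BSymbol.reedMuller F r m)) := by
  subst hq hr
  obtain ⟨b, rfl⟩ := Nat.exists_eq_add_of_le' hb1
  have hC : BSymbol.reedMuller F (t * (Fintype.card F - 1) + s) m ≠ ⊥ :=
    BSymbol.reedMuller_ne_bot
  rcases lt_or_ge t m with htm | htm
  · have hmin := BSymbol.rmDist_le_minDist_reedMuller (F := F) (m := m) (t := t) hs
    have hcond : (((b + 1 : ℕ) : ℚ) ≥ (Fintype.card F : ℚ) ^ m - ((Fintype.card F : ℚ) - (s : ℚ)) *
        (Fintype.card F : ℚ) ^ ((m : ℤ) - (t : ℤ) - 1) + 1) ↔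
        Fintype.card F ^ m ≤ BSymbol.rmDist (Fintype.card F) m t s + b := by
      rw [BSymbol.rmDist_of_lt htm, ← Nat.cast_le (α := ℚ),
        show (m : ℤ) - t - 1 = ((m - t - 1 : ℕ) : ℤ) by omega, zpow_natCast]
      push_cast [Nat.cast_sub (show s ≤ Fintype.card F by omega)]
      constructor <;> intro h <;> linarith
    rw [hcond]
    constructor
    · intro h
      by_contra! hcon
      obtain ⟨hlt, hnot⟩ := hcon
      obtain ⟨c, hc, hc0, hlast⟩ :=
        BSymbol.exists_mem_reedMuller_last (F := F) (t := ⟨t, htm⟩) hs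
      refine hnot (h.one_of_lt hC ?_ hmin hc hc0 hlast hlt)
      rw [BSymbol.rmDist_of_lt htm]
      exact Nat.mul_pos (by omega) (pow_pos Fintype.card_pos _)
    · rintro (h | h)
      · exact BSymbol.isMDS_of_length_le hC (by omega)
      · exact h.of_one b hC
  · have htop := BSymbol.reedMuller_eq_top (F := F) (m := m)
      (Nat.le_add_right_of_le (k := s) (Nat.mul_le_mul_right (Fintype.card F - 1) htm))
    have hone : BSymbol.IsMDS 1 (BSymbol.reedMuller F (t * (Fintype.card F - 1) + s) m) := by
      rw [htop]
      exact BSymbol.isMDS_one_top (pow_pos Fintype.card_pos m)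
    exact ⟨fun _ => Or.inr hone, fun _ => hone.of_one b hC⟩
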